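/- Let $n\ge 1$, let $S\subseteq\mathbb{R}^n$ be a measurable set of positive Lebesgue measure, and write $\langle f\rangle=\int_S f\,dx$. For $\gamma>0$ let $\mathcal{P}_\gamma$ be the set of probability densities $p$ on $S$ with $\langle p^{1+\gamma}\rangle<\infty$, and $\|p\|_{1+\gamma}=\langle p^{1+\gamma}\rangle^{1/(1+\gamma)}$. For $q,p\in\mathcal{P}_\gamma$, $\gamma>0$, define the following cross-entropies (each determines the divergence $D(q,p)=d(q,p)-d(q,q)$). * NB-DPD (norm-based Bregman density power): for functions $\phi_g:[0,\infty)\to\mathbb{R}$ $(g\ge 0)$, each strictly increasing, convex, and differentiable on $(0,\infty)$, $$d^{\rm NB}_{\phi,\gamma}(q,p)=-\frac{\phi_\gamma(\|p\|_{1+\gamma})-\phi_0(1)}{\gamma}-\frac{\phi_\gamma'(\|p\|_{1+\gamma})\,(\langle qp^\gamma\rangle-\langle p^{1+\gamma}\rangle)}{\gamma\,\|p\|_{1+\gamma}^{\gamma}}.$$ For $\gamma=0$, with $g\mapsto\phi_g(1)$ moreover differentiable from the right at $0$, $$d^{\rm NB}_{\phi,0}(q,p)=-\phi_0'(1)\langle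 q\log p\rangle-\partial_g\phi_g(1)|_{g=0},$$ for densities $q,p$ such that $q=0$ a.e. on $\{p=0\}$ and $q\log p$ is integrable. * Hölder: for $H:[0,\infty)\to\mathbb{R}$ with $H(z)\ge -z^{1+\gamma}$ for all $z\ge0$ and $H(1)=-1$, $$d_{H,\gamma}(q,p)=\frac1\gamma H\!\left(\frac{\langle qp^\gamma\rangle}{\langle p^{1+\gamma}\rangle}\right)\langle p^{1+\gamma}\rangle+\frac1\gamma .$$ * Bregman–Hölder: for $\kappa\ge1$, $$d^{\rm BH}_{\kappa,\gamma}(q,p)=\frac{\kappa}{\gamma}\|p\|_{1+\gamma}^{\kappa}\left(1-\frac1\kappa-\frac{\langle qp^\gamma\rangle}{\langle p^{1+\gamma}\rangle}\right)+\frac1\gamma .$$ Call $d$ and $\tilde d$ equivalent if $\tilde d(q,p)=\xi(d(q,p))$, for all pairs $(q,p)$ at which both are defined, with some strictly increasing $\xi:\mathbb{R}\to\mathbb{R}$; call them weakly equivalent if $\xi$ is only required to be strictly increasing on the set of values of $d$ at these pairs. **Corollary 1.** Up to equivalence, the intersection of the NB-DPD class and the Hölder class is exactly the Bregman–Hölder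 class: 1. If $\gamma\ge0$, $\gamma'>0$, and $\phi$, $H$ are as above (for $\gamma$ and $\gamma'$, respectively) with $d^{\rm NB}_{\phi,\gamma}$ weakly equivalent to $d_{H,\gamma'}$, then $\gamma=\gamma'$ and there is $\kappa\ge1$ such that $d^{\rm BH}_{\kappa,\gamma}$ is equivalent to $d^{\rm NB}_{\phi,\gamma}$. 2. Conversely, for all $\gamma>0$ and $\kappa\ge1$ there are $\phi$ and $H$ as above such that $d^{\rm BH}_{\kappa,\gamma}$ is equivalent to $d^{\rm NB}_{\phi,\gamma}$ and to $d_{H,\gamma}$. -/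

import Mathlib

open MeasureTheory

namespace NBDPD

noncomputable section

variable {X : Type*} [MeasurableSpace X]

/-- `p` is a probability density with respect to `ν`. -/
structure IsDensity (ν : Measure X) (p : X → ℝ) : Prop where
  nonneg : 0 ≤ᵐ[ν] p
  integrable : Integrable p ν
  integral_eq_one : ∫ x, p x ∂ν = 1

/-- The probability densities `p` with `⟨p ^ (1 + γ)⟩ < ∞`. -/
def DensityClass (ν : Measure X) (γ : ℝ) : Set (X → ℝ) :=
  {p | IsDensity ν p ∧ Integrable (fun x => p x ^ (1 + γ)) ν}

/-- `⟨p ^ (1 + γ)⟩`. -/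
def powInt (ν : Measure X) (γ : ℝ) (p : X → ℝ) : ℝ :=
  ∫ x, p x ^ (1 + γ) ∂ν

/-- `⟨q p ^ γ⟩`. -/
def crossInt (ν : Measure X) (γ : ℝ) (q p : X → ℝ) : ℝ :=
  ∫ x, q x * p x ^ γ ∂ν

/-- The `L_{1+γ}` norm of a density. -/
def lnorm (ν : Measure X) (γ : ℝ) (p : X → ℝ) : ℝ :=
  powInt ν γ p ^ (1 / (1 + γ))

/-- A real functional of an ordered pair `(q, p)` of densities, together with the set of pairs
at which it is defined (all integrals in its formula converge). -/
structure PairFunctional (X : Type*) where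
  dom : Set ((X → ℝ) × (X → ℝ))
  val : (X → ℝ) → (X → ℝ) → ℝ

/-- Equivalence of cross-entropies: `d' = ξ ∘ d` for a strictly increasing `ξ : ℝ → ℝ`, at all
pairs of densities where both are defined. -/
def Equivalent (d d' : PairFunctional X) : Prop :=
  ∃ ξ : ℝ → ℝ, StrictMono ξ ∧
    ∀ q p, (q, p) ∈ d.dom → (q, p) ∈ d'.dom → d'.val q p = ξ (d.val q p)

/-- Equivalence where `ξ` need be strictly increasing only on the values which `d` attains.
This admits transformations such as a logarithm, which do not extend to an increasing function
on all of `ℝ`, and it is symmetric in `d` and `d'`. -/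
def WeaklyEquivalent (d d' : PairFunctional X) : Prop :=
  ∃ ξ : ℝ → ℝ,
    StrictMonoOn ξ {y | ∃ q p, (q, p) ∈ d.dom ∧ (q, p) ∈ d'.dom ∧ d.val q p = y} ∧
    ∀ q p, (q, p) ∈ d.dom → (q, p) ∈ d'.dom → d'.val q p = ξ (d.val q p)

/-- The family `γ ↦ φ γ` generates a norm-based Bregman density power cross-entropy with power
parameter `γ`. Each `φ g : ℝ₊ → ℝ` is strictly increasing, convex and differentiable; only its
values on `[0, ∞)` matter. The parameter derivative enters the cross-entropy for `γ = 0` only. -/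
structure IsNBGenerator (φ : ℝ → ℝ → ℝ) (γ : ℝ) : Prop where
  strictMonoOn : ∀ g, 0 ≤ g → StrictMonoOn (φ g) (Set.Ici 0)
  convexOn : ∀ g, 0 ≤ g → ConvexOn ℝ (Set.Ici 0) (φ g)
  differentiableOn : ∀ g, 0 ≤ g → DifferentiableOn ℝ (φ g) (Set.Ioi 0)
  param_differentiable : γ = 0 →
    DifferentiableWithinAt ℝ (fun g => φ g 1) (Set.Ici 0) 0

open Classical in
/-- Norm-based Bregman density power cross-entropy. For `γ = 0` it is an affine function of the
Shannon cross-entropy `-⟨q log p⟩`, which is finite if `q` vanishes where `p` does and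
`q log p` is integrable. -/
def nbCE (ν : Measure X) (φ : ℝ → ℝ → ℝ) (γ : ℝ) : PairFunctional X where
  dom := if γ = 0 then
      {z | IsDensity ν z.1 ∧ IsDensity ν z.2 ∧ (∀ᵐ x ∂ν, z.2 x = 0 → z.1 x = 0) ∧
        Integrable (fun x => z.1 x * Real.log (z.2 x)) ν}
    else DensityClass ν γ ×ˢ DensityClass ν γ
  val q p := if γ = 0 then
      -(deriv (φ 0) 1 * ∫ x, q x * Real.log (p x) ∂ν)
        - derivWithin (fun g => φ g 1) (Set.Ici 0) 0
    else
      -((φ γ (lnorm ν γ p) - φ 0 1) / γ)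
        - deriv (φ γ) (lnorm ν γ p) * (crossInt ν γ q p - powInt ν γ p)
            / (γ * lnorm ν γ p ^ γ)

/-- The functions `H : ℝ₊ → ℝ` which define Hölder cross-entropies with parameter `γ`. -/
structure IsHolderGenerator (H : ℝ → ℝ) (γ : ℝ) : Prop where
  lower_bound : ∀ z, 0 ≤ z → -z ^ (1 + γ) ≤ H z
  at_one : H 1 = -1

/-- Hölder cross-entropy, `γ > 0`. -/
def holderCE (ν : Measure X) (H : ℝ → ℝ) (γ : ℝ) : PairFunctional X where
  dom := DensityClass ν γ ×ˢ DensityClass ν γ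
  val q p := 1 / γ * H (crossInt ν γ q p / powInt ν γ p) * powInt ν γ p + 1 / γ

/-- Bregman–Hölder cross-entropy, `γ > 0`, `κ ≥ 1`. -/
def bregmanHolderCE (ν : Measure X) (κ γ : ℝ) : PairFunctional X where
  dom := DensityClass ν γ ×ˢ DensityClass ν γ
  val q p := κ / γ * lnorm ν γ p ^ κ * (1 - 1 / κ - crossInt ν γ q p / powInt ν γ p) + 1 / γ

end

end NBDPD

/-! Put `N = ‖p‖_{1+γ}`, `ζ = ⟨q p^γ⟩ / ⟨p^(1+γ)⟩` and `h = -H`. For `γ > 0`, up to decreasing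
affine maps, the NB-DPD, Hölder and Bregman–Hölder cross-entropies are `φ(N) + N φ'(N) (ζ - 1)`,
`N^(1+γ) h(ζ)` and `N^κ (1 + κ (ζ - 1))`. The third is the first with `φ(x) = x^κ`, and becomes the
second when raised to the power `(1+γ)/κ`; this gives the converse.

For the direct part, `power_eq_of_weaklyEquivalent` shows that the powers agree: for a three-step
`p`, two densities `q` have equal `⟨q p^γ'⟩`, hence equal cross-entropies, while strict convexity or
concavity separates `⟨q p^γ⟩` (or `⟨q log p⟩`) if `γ ≠ γ'`.

With equal powers, spikes realize every pair `(N, ζ)` with `ζ ≥ 0` and `N` above the infimum `c` of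
the norms (`exists_lnorm_threshold`). So the first two expressions induce the same order on these
pairs. Comparing `(x, ζ)` with `(t x, 1)` gives `h(ζ) = t^(1+γ)` for `ζ = 1 + (φ(t x) - φ(x)) / (x
φ'(x))`; since `h` is injective, this `ζ` depends on `t` only. The resulting functional equation
(`exists_eq_add_mul_rpow`) forces `φ(x) = a + b x^κ`, and convexity gives `κ ≥ 1`. -/

namespace NBDPD

/-! ### Sets of prescribed measure. -/

/-- Every measurable set has measurable subsets of each smaller finite positive measure. -/
def HasSubsetsOfMeasure {X : Type*} [MeasurableSpace X] (ν : Measure X) : Prop :=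
  ∀ (T : Set X) (t : ℝ), MeasurableSet T → 0 < t → ENNReal.ofReal t < ν T →
    ∃ A ⊆ T, MeasurableSet A ∧ ν A = ENNReal.ofReal t

/-- Intersect with balls about the origin. The measure of the intersection is continuous in the
radius, because its increments are at most those of the volume of the ball, and it vanishes at
radius 0 since `n ≥ 1`; the intermediate value theorem applies. -/
theorem hasSubsetsOfMeasure_volume_restrict {n : ℕ} (hn : 1 ≤ n)
    {S : Set (EuclideanSpace ℝ (Fin n))} (hS : MeasurableSet S) :
    HasSubsetsOfMeasure (volume.restrict S) := by
  intro T t hT ht htT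
  have hne : Nonempty (Fin n) := ⟨⟨0, hn⟩⟩
  rw [Measure.restrict_apply hT] at htT
  set U := T ∩ S with hU
  have hUm : MeasurableSet U := hT.inter hS
  let B : ℝ → Set (EuclideanSpace ℝ (Fin n)) := fun r => Metric.closedBall 0 r
  let f : ℝ → ℝ := fun r => volume.real (U ∩ B r)
  let g : ℝ → ℝ := fun r => volume.real (B r)
  have hBfin : ∀ r, volume (B r) ≠ ⊤ := fun r => measure_closedBall_lt_top.ne
  have hUBfin : ∀ r, volume (U ∩ B r) ≠ ⊤ := fun r =>
    measure_ne_top_of_subset Set.inter_subset_right (hBfin r)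
  have hBmono : Monotone B := fun r s h => Metric.closedBall_subset_closedBall h
  have hg : ∀ r, 0 ≤ r → g r = r ^ n * volume.real (Metric.ball (0 : EuclideanSpace ℝ (Fin n)) 1) := by
    intro r hr
    have := Measure.addHaar_closedBall (volume : Measure (EuclideanSpace ℝ (Fin n))) 0 hr
    simp only [g, B, Measure.real, this, ENNReal.toReal_mul]
    rw [ENNReal.toReal_ofReal (by positivity)]
    simp
  have hgc : ContinuousOn g (Set.Ici 0) := by
    refine ContinuousOn.congr (f := fun r => r ^ n *
      volume.real (Metric.ball (0 : EuclideanSpace ℝ (Fin n)) 1)) ?_ (fun r hr => hg r hr)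
    fun_prop
  have hfmono : ∀ r s, r ≤ s → f r ≤ f s := fun r s h =>
    measureReal_mono (Set.inter_subset_inter_right _ (hBmono h)) (hUBfin s)
  have hfg : ∀ r s, r ≤ s → f s - f r ≤ g s - g r := by
    intro r s h
    have h1 : U ∩ B s ⊆ (U ∩ B r) ∪ (B s \ B r) := by
      intro x hx
      by_cases hxr : x ∈ B r
      · exact Or.inl ⟨hx.1, hxr⟩
      · exact Or.inr ⟨hx.2, hxr⟩
    have h2 : f s ≤ f r + volume.real (B s \ B r) :=
      (measureReal_mono h1 (by
        refine measure_union_ne_top (hUBfin r) ?_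
        exact measure_ne_top_of_subset Set.sdiff_subset (hBfin s))).trans
        (measureReal_union_le _ _)
    have h3 : volume.real (B s \ B r) = g s - g r :=
      measureReal_sdiff (hBmono h) Metric.isClosed_closedBall.measurableSet
        (hBfin s)
    linarith
  have hfgabs : ∀ r s, |f s - f r| ≤ |g s - g r| := by
    intro r s
    rcases le_total r s with h | h
    · rw [abs_of_nonneg (sub_nonneg.2 (hfmono r s h))]
      exact (hfg r s h).trans (le_abs_self _)
    · rw [abs_sub_comm, abs_sub_comm (g s), abs_of_nonneg (sub_nonneg.2 (hfmono s r h))]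
      exact (hfg s r h).trans (le_abs_self _)
  have hfc : ContinuousOn f (Set.Ici 0) := by
    intro r hr
    have := hgc r hr
    rw [Metric.continuousWithinAt_iff] at this ⊢
    intro ε hε
    obtain ⟨δ, hδ, h⟩ := this ε hε
    exact ⟨δ, hδ, fun {s} hs hsr => lt_of_le_of_lt (hfgabs r s) (h hs hsr)⟩
  have hf0 : f 0 = 0 := by
    have : g 0 = 0 := by
      rw [hg 0 le_rfl, zero_pow (by omega), zero_mul]
    refine le_antisymm ?_ measureReal_nonneg
    refine le_of_le_of_eq ?_ this
    exact measureReal_mono Set.inter_subset_right (hBfin 0)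
  obtain ⟨k, hk⟩ : ∃ k : ℕ, ENNReal.ofReal t < volume (U ∩ B k) := by
    have hmono : Monotone fun k : ℕ => U ∩ B k := fun i j h =>
      Set.inter_subset_inter_right _ (hBmono (by exact_mod_cast h))
    have hun : ⋃ k : ℕ, U ∩ B k = U := by
      rw [← Set.inter_iUnion]
      have : ⋃ k : ℕ, B k = Set.univ := Metric.iUnion_closedBall_nat 0
      rw [this, Set.inter_univ]
    have := hmono.measure_iUnion (μ := volume)
    rw [hun] at this
    rw [this] at htT
    exact lt_iSup_iff.1 htT
  have htk : t ≤ f k := (ENNReal.ofReal_le_iff_le_toReal (hUBfin k)).1 hk.le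
  obtain ⟨r, hr, hrt⟩ := intermediate_value_Icc (Nat.cast_nonneg k)
    (hfc.mono Set.Icc_subset_Ici_self) (show t ∈ Set.Icc (f 0) (f k) from ⟨by linarith, htk⟩)
  refine ⟨U ∩ B r, fun x hx => hx.1.1,
    hUm.inter Metric.isClosed_closedBall.measurableSet, ?_⟩
  rw [Measure.restrict_apply (hUm.inter Metric.isClosed_closedBall.measurableSet),
    Set.inter_eq_left.2 fun x hx => hx.1.2, ← hrt]
  exact (ENNReal.ofReal_toReal (hUBfin r)).symm

/-- Disjoint sets of prescribed measures. -/
theorem HasSubsetsOfMeasure.exists_disjoint_triple {X : Type*} [MeasurableSpace X]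
    {ν : Measure X} (hν : HasSubsetsOfMeasure ν) (m : Fin 3 → ℝ) (hm : ∀ i, 0 < m i)
    (hlt : ENNReal.ofReal (m 0 + m 1 + m 2) < ν Set.univ) :
    ∃ A : Fin 3 → Set X, (∀ i, MeasurableSet (A i)) ∧ Pairwise (Function.onFun Disjoint A) ∧
      ∀ i, ν (A i) = ENNReal.ofReal (m i) := by
  have h0 := hm 0
  have h1 := hm 1
  have h2 := hm 2
  obtain ⟨A, -, hA, hAm⟩ := hν Set.univ (m 0) MeasurableSet.univ h0
    ((ENNReal.ofReal_le_ofReal (by linarith)).trans_lt hlt)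
  have key : ∀ (B : Set X) (b c : ℝ), MeasurableSet B → ν B = ENNReal.ofReal b → 0 ≤ b → 0 ≤ c →
      ENNReal.ofReal (b + c) < ν Set.univ → ENNReal.ofReal c < ν Bᶜ := by
    intro B b c hB hBb hb hc h
    rw [← measure_add_measure_compl hB, hBb, ENNReal.ofReal_add hb hc] at h
    exact lt_of_add_lt_add_left h
  obtain ⟨B, hBA, hB, hBm⟩ := hν Aᶜ (m 1) hA.compl h1
    (key A _ _ hA hAm h0.le h1.le ((ENNReal.ofReal_le_ofReal (by linarith)).trans_lt hlt))
  have hAB : Disjoint A B := Set.disjoint_left.2 fun x hx hx' => hBA hx' hx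
  have hABm : ν (A ∪ B) = ENNReal.ofReal (m 0 + m 1) := by
    rw [measure_union hAB hB, hAm, hBm, ENNReal.ofReal_add h0.le h1.le]
  obtain ⟨C, hCA, hC, hCm⟩ := hν (A ∪ B)ᶜ (m 2) (hA.union hB).compl h2
    (key _ _ _ (hA.union hB) hABm (by positivity) h2.le hlt)
  have hAC : Disjoint A C := Set.disjoint_left.2 fun x hx hx' => hCA hx' (Or.inl hx)
  have hBC : Disjoint B C := Set.disjoint_left.2 fun x hx hx' => hCA hx' (Or.inr hx)
  refine ⟨![A, B, C], ?_, ?_, ?_⟩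
  · intro i; fin_cases i <;> assumption
  · intro i j hij
    fin_cases i <;> fin_cases j <;> first | exact absurd rfl hij | skip
    exacts [hAB, hAC, hAB.symm, hBC, hAC.symm, hBC.symm]
  · intro i; fin_cases i <;> assumption

/-! ### Integrals of step functions. -/

section Step

variable {X ι : Type*} [Fintype ι]

/-- The function with value `v i` on `A i`, and `0` outside of these sets. -/
noncomputable def step (A : ι → Set X) (v : ι → ℝ) (x : X) : ℝ :=
  ∑ i, (A i).indicator (fun _ => v i) x

variable {A : ι → Set X} (hA : Pairwise (Function.onFun Disjoint A))
include hA

theorem step_of_mem (v : ι → ℝ) {i : ι} {x : X} (hx : x ∈ A i) : step A v x = v i := by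
  rw [step, Finset.sum_eq_single i]
  · simp [hx]
  · intro j _ hji
    exact Set.indicator_of_notMem (fun hj => Set.disjoint_left.1 (hA hji) hj hx) _
  · simp

omit hA in
theorem step_of_forall_notMem (v : ι → ℝ) {x : X} (hx : ∀ i, x ∉ A i) : step A v x = 0 :=
  Finset.sum_eq_zero fun i _ => Set.indicator_of_notMem (hx i) _

theorem comp_step (G : ℝ → ℝ → ℝ) (hG : G 0 0 = 0) (w v : ι → ℝ) :
    (fun x => G (step A w x) (step A v x)) = step A fun i => G (w i) (v i) := by
  ext x
  by_cases hx : ∃ i, x ∈ A i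
  · obtain ⟨i, hi⟩ := hx
    simp only [step_of_mem hA _ hi]
  · push Not at hx
    simp only [step_of_forall_notMem _ hx, hG]

omit hA
variable [MeasurableSpace X] {ν : Measure X} {m : ι → ℝ}
  (hm : ∀ i, 0 < m i) (hAm : ∀ i, MeasurableSet (A i)) (hν : ∀ i, ν (A i) = ENNReal.ofReal (m i))
include hm hAm hν

omit hm in
theorem integrable_step (v : ι → ℝ) : Integrable (step A v) ν := by
  refine integrable_finsetSum _ fun i _ => ?_
  rw [integrable_indicator_iff (hAm i)]
  exact integrableOn_const (by simp [hν])

theorem integral_step (v : ι → ℝ) : ∫ x, step A v x ∂ν = ∑ i, m i * v i := by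
  unfold step
  rw [integral_finsetSum]
  · refine Finset.sum_congr rfl fun i _ => ?_
    rw [integral_indicator (hAm i), setIntegral_const, Measure.real, hν,
      ENNReal.toReal_ofReal (hm i).le, smul_eq_mul]
  · intro i _
    rw [integrable_indicator_iff (hAm i)]
    exact integrableOn_const (by simp [hν])

include hA

omit hA in
theorem isDensity_step {v : ι → ℝ} (hv : ∀ i, 0 ≤ v i) (h1 : ∑ i, m i * v i = 1) :
    IsDensity ν (step A v) where
  nonneg := .of_forall fun x => Finset.sum_nonneg fun i _ => Set.indicator_nonneg (fun _ _ => hv i) x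
  integrable := integrable_step hAm hν v
  integral_eq_one := by rw [integral_step hm hAm hν, h1]

theorem step_mem_densityClass {γ : ℝ} (hγ : 0 < γ) {v : ι → ℝ} (hv : ∀ i, 0 ≤ v i)
    (h1 : ∑ i, m i * v i = 1) : step A v ∈ DensityClass ν γ := by
  refine ⟨isDensity_step hm hAm hν hv h1, ?_⟩
  rw [comp_step hA (fun _ b => b ^ (1 + γ)) (Real.zero_rpow (by positivity)) v v]
  exact integrable_step hAm hν _

theorem powInt_step {γ : ℝ} (hγ : 0 < γ) (v : ι → ℝ) :
    powInt ν γ (step A v) = ∑ i, m i * v i ^ (1 + γ) := by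
  rw [powInt, comp_step hA (fun _ b => b ^ (1 + γ)) (Real.zero_rpow (by positivity)) v v,
    integral_step hm hAm hν]

theorem crossInt_step (γ : ℝ) (w v : ι → ℝ) :
    crossInt ν γ (step A w) (step A v) = ∑ i, m i * (w i * v i ^ γ) := by
  rw [crossInt, comp_step hA (fun a b => a * b ^ γ) (zero_mul _) w v,
    integral_step hm hAm hν]

end Step

/-! ### Convex functions and the functional equation for powers. -/

theorem deriv_pos_of_convexOn {φ : ℝ → ℝ} (hmono : StrictMonoOn φ (Set.Ici 0))
    (hconv : ConvexOn ℝ (Set.Ici 0) φ) {x : ℝ} (hx : 0 < x) (hd : DifferentiableAt ℝ φ x) :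
    0 < deriv φ x := by
  -- The derivative is at least the slope of the chord from 0, which is positive.
  have h1 := hconv.slope_le_deriv (Set.mem_Ici.2 le_rfl) (Set.mem_Ici.2 hx.le) hx hd
  have h2 : φ 0 < φ x := hmono (Set.mem_Ici.2 le_rfl) (Set.mem_Ici.2 hx.le) hx
  refine lt_of_lt_of_le ?_ h1
  rw [slope_def_field]
  exact div_pos (by linarith) (by linarith)

theorem deriv_mul_sub_le_of_convexOn {φ : ℝ → ℝ} (hconv : ConvexOn ℝ (Set.Ici 0) φ) {x y : ℝ}
    (hx : 0 ≤ x) (hy : 0 ≤ y) (hd : DifferentiableAt ℝ φ x) :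
    deriv φ x * (y - x) ≤ φ y - φ x := by
  rcases lt_trichotomy x y with h | h | h
  · have h1 := hconv.deriv_le_slope (Set.mem_Ici.2 hx) (Set.mem_Ici.2 hy) h hd
    rwa [slope_def_field, le_div_iff₀ (by linarith)] at h1
  · simp [h]
  · have h1 := hconv.slope_le_deriv (Set.mem_Ici.2 hy) (Set.mem_Ici.2 hx) h hd
    rw [slope_def_field, div_le_iff₀ (by linarith)] at h1
    linarith

/-- A function whose increments along dilations, relative to `x ↦ x φ'(x)`, depend on the
dilation factor only, and whose derivative is increasing, is an affine function of a power. -/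
theorem exists_eq_add_mul_rpow {φ : ℝ → ℝ} {c : ℝ} (hc : 0 ≤ c)
    (hd : ∀ x, c < x → DifferentiableAt ℝ φ x) (hpos : ∀ x, c < x → 0 < deriv φ x)
    (hmono : StrictMonoOn φ (Set.Ioi c)) (hderiv : MonotoneOn (deriv φ) (Set.Ioi c))
    (hfe : ∀ x y t, c < x → c < y → c < t * x → c < t * y →
      (φ (t * x) - φ x) * (y * deriv φ y) = (φ (t * y) - φ y) * (x * deriv φ x)) :
    ∃ κ b a : ℝ, 1 ≤ κ ∧ 0 < b ∧ ∀ x, c < x → φ x = a + b * x ^ κ := by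
  set ψ : ℝ → ℝ := fun x => x * deriv φ x with hψ
  have hψpos : ∀ x, c < x → 0 < ψ x := fun x hx => mul_pos (hc.trans_lt hx) (hpos x hx)
  have hmul : ∀ x y t, c < x → c < y → c < t * x → c < t * y →
      ψ (t * x) * ψ y = ψ (t * y) * ψ x := by
    -- Differentiate the functional equation in `t`.
    intro x y t hx hy htx hty
    have hdt : ∀ z, c < t * z → HasDerivAt (fun s => φ (s * z)) (deriv φ (t * z) * z) t := by
      intro z hz
      have := (hd _ hz).hasDerivAt.comp t ((hasDerivAt_id t).mul_const z)
      simpa [Function.comp_def] using this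
    have h1 := ((hdt x htx).sub_const (φ x)).mul_const (ψ y)
    have h2 := ((hdt y hty).sub_const (φ y)).mul_const (ψ x)
    have heq : (fun s => (φ (s * x) - φ x) * ψ y) =ᶠ[nhds t]
        fun s => (φ (s * y) - φ y) * ψ x := by
      have e1 : ∀ᶠ s in nhds t, c < s * x :=
        (continuousAt_id.mul continuousAt_const).eventually_const_lt htx
      have e2 : ∀ᶠ s in nhds t, c < s * y :=
        (continuousAt_id.mul continuousAt_const).eventually_const_lt hty
      filter_upwards [e1, e2] with s hs1 hs2
      exact hfe x y s hx hy hs1 hs2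
    have := h1.unique (h2.congr_of_eventuallyEq heq)
    simp only [hψ] at this ⊢
    linear_combination t * this
  have hψd : ∀ x, c < x → DifferentiableAt ℝ ψ x := by
    intro x hx
    have hx0 : 0 < x := hc.trans_lt hx
    set M := x + 1 with hM
    have hMc : c < M := by linarith
    -- No second derivative of `φ` is assumed. The dilation `M / y` sends `y` to the fixed point
    -- `M`, so the functional equation expresses `ψ y` through values of `φ` alone.
    have heq : ψ =ᶠ[nhds x]
        fun y => (φ M - φ y) * ψ x / (φ (M / y * x) - φ x) := by
      have e1 : ∀ᶠ y in nhds x, c < y := eventually_gt_nhds hx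
      have e2 : ∀ᶠ y in nhds x, y < M := eventually_lt_nhds (by linarith)
      filter_upwards [e1, e2] with y hy1 hy2
      have hy0 : 0 < y := hc.trans_lt hy1
      have h1 : M / y * y = M := div_mul_cancel₀ _ hy0.ne'
      have hlt : x < M / y * x := by
        rw [lt_mul_iff_one_lt_left hx0, one_lt_div hy0]; exact hy2
      have h2 := hfe y x (M / y) hy1 hx (by rw [h1]; exact hMc) (hx.trans hlt)
      rw [h1] at h2
      have h3 : φ x < φ (M / y * x) := hmono hx (hx.trans hlt) hlt
      rw [eq_div_iff (by linarith)]
      simp only [hψ]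
      linarith
    refine DifferentiableAt.congr_of_eventuallyEq ?_ heq
    have hMx : M / x * x = M := div_mul_cancel₀ _ hx0.ne'
    refine DifferentiableAt.div (((hd x hx).const_sub _).mul_const _) ?_ ?_
    · refine DifferentiableAt.sub_const ?_ _
      refine DifferentiableAt.comp (g := φ) x (by rw [hMx]; exact hd M hMc) ?_
      exact ((differentiableAt_const M).div differentiableAt_id hx0.ne').mul_const x
    · rw [hMx]
      have : φ x < φ M := hmono hx hMc (by linarith)
      linarith
  obtain ⟨z, hz⟩ : ∃ z, c < z := exists_gt c
  set κ := z * deriv ψ z / ψ z with hκ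
  -- Differentiating `ψ (s x) ψ z = ψ (s z) ψ x` at `s = 1` gives Euler's equation, whose solutions
  -- are multiples of `x ^ κ`.
  have hode : ∀ x, c < x → x * deriv ψ x = κ * ψ x := by
    intro x hx
    have hdt : ∀ y, c < y → HasDerivAt (fun s => ψ (s * y)) (deriv ψ y * y) 1 := by
      intro y hy
      have := HasDerivAt.comp (h₂ := ψ) (h₂' := deriv ψ y) 1
        (by simpa only [id, one_mul] using (hψd y hy).hasDerivAt) ((hasDerivAt_id (1 : ℝ)).mul_const y)
      simpa [Function.comp_def] using this
    have h1 := (hdt x hx).mul_const (ψ z)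
    have h2 := (hdt z hz).mul_const (ψ x)
    have heq : (fun s => ψ (s * x) * ψ z) =ᶠ[nhds 1] fun s => ψ (s * z) * ψ x := by
      have e1 : ∀ᶠ s : ℝ in nhds 1, c < s * x :=
        (continuousAt_id.mul continuousAt_const).eventually_const_lt (by simpa using hx)
      have e2 : ∀ᶠ s : ℝ in nhds 1, c < s * z :=
        (continuousAt_id.mul continuousAt_const).eventually_const_lt (by simpa using hz)
      filter_upwards [e1, e2] with s hs1 hs2
      exact hmul x z s hx hz hs1 hs2
    have := h1.unique (h2.congr_of_eventuallyEq heq)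
    have hz' := (hψpos z hz).ne'
    rw [hκ]
    field_simp
    linarith
  have hconst : ∃ b, ∀ x, c < x → ψ x * x ^ (-κ) = b := by
    have hda : ∀ x, c < x → HasDerivAt (fun x => ψ x * x ^ (-κ)) 0 x := by
      intro x hx
      have hx0 : 0 < x := hc.trans_lt hx
      have := (hψd x hx).hasDerivAt.mul (Real.hasDerivAt_rpow_const (p := -κ) (Or.inl hx0.ne'))
      refine this.congr_deriv ?_
      have h3 : x ^ (-κ) = x ^ (-κ - 1) * x := by
        rw [← Real.rpow_add_one hx0.ne']; congr 1; ring
      rw [h3]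
      linear_combination x ^ (-κ - 1) * hode x hx
    obtain ⟨b, hb⟩ := isOpen_Ioi.exists_is_const_of_deriv_eq_zero isPreconnected_Ioi
      (fun x hx => (hda x hx).differentiableAt.differentiableWithinAt)
      (fun x hx => (hda x hx).deriv)
    exact ⟨b, hb⟩
  obtain ⟨b, hb⟩ := hconst
  have hb0 : 0 < b := by
    rw [← hb z hz]
    exact mul_pos (hψpos z hz) (Real.rpow_pos_of_pos (hc.trans_lt hz) _)
  have hφ' : ∀ x, c < x → deriv φ x = b * x ^ (κ - 1) := by
    intro x hx
    have hx0 : 0 < x := hc.trans_lt hx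
    rw [← hb x hx, mul_assoc, ← Real.rpow_add hx0]
    have : -κ + (κ - 1) = -1 := by ring
    rw [this, Real.rpow_neg_one]
    simp only [hψ]
    field_simp
  -- Otherwise `φ'` would decrease. This also excludes `κ = 0`, where `φ` would be a logarithm.
  have hκ1 : 1 ≤ κ := by
    by_contra! hlt
    have hz0 : 0 < z := hc.trans_lt hz
    have h1 := hderiv hz (show c < 2 * z by linarith) (by linarith)
    rw [hφ' z hz, hφ' (2 * z) (by linarith)] at h1
    have h2 : (2 * z) ^ (κ - 1) < z ^ (κ - 1) :=
      Real.rpow_lt_rpow_of_neg hz0 (by linarith) (by linarith)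
    nlinarith
  have hφ : ∃ a, ∀ x, c < x → φ x - b / κ * x ^ κ = a := by
    have hda : ∀ x, c < x → HasDerivAt (fun x => φ x - b / κ * x ^ κ) 0 x := by
      intro x hx
      have hx0 : 0 < x := hc.trans_lt hx
      have := (hd x hx).hasDerivAt.sub
        ((Real.hasDerivAt_rpow_const (p := κ) (Or.inl hx0.ne')).const_mul (b / κ))
      refine this.congr_deriv ?_
      rw [hφ' x hx]
      field_simp
      ring
    obtain ⟨a, ha⟩ := isOpen_Ioi.exists_is_const_of_deriv_eq_zero isPreconnected_Ioi
      (fun x hx => (hda x hx).differentiableAt.differentiableWithinAt)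
      (fun x hx => (hda x hx).deriv)
    exact ⟨a, ha⟩
  obtain ⟨a, ha⟩ := hφ
  exact ⟨κ, b / κ, a, hκ1, by positivity, fun x hx => by linarith [ha x hx]⟩

/-- Serves to include the endpoint `x = c`, the norm of the uniform density when the measure is
finite. Limits and derivatives from the right suffice there. -/
theorem eq_add_mul_rpow_of_forall_gt {φ : ℝ → ℝ} {c κ b a : ℝ}
    (h : ∀ x, c < x → φ x = a + b * x ^ κ) {x : ℝ} (hx : 0 < x) (hcx : c ≤ x)
    (hd : DifferentiableAt ℝ φ x) :
    φ x = a + b * x ^ κ ∧ deriv φ x = b * (κ * x ^ (κ - 1)) := by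
  have hda : HasDerivAt (fun x => a + b * x ^ κ) (b * (κ * x ^ (κ - 1))) x :=
    ((Real.hasDerivAt_rpow_const (Or.inl hx.ne')).const_mul b).const_add a
  have heq : φ =ᶠ[nhdsWithin x (Set.Ioi x)] fun x => a + b * x ^ κ :=
    eventually_nhdsWithin_of_forall fun y hy => h y (hcx.trans_lt hy)
  have hval : φ x = a + b * x ^ κ :=
    tendsto_nhds_unique_of_eventuallyEq hd.continuousAt.continuousWithinAt
      hda.continuousAt.continuousWithinAt heq
  refine ⟨hval, ?_⟩
  have h1 := hd.hasDerivAt.hasDerivWithinAt (s := Set.Ioi x)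
  have h2 := (hda.hasDerivWithinAt (s := Set.Ioi x)).congr_of_eventuallyEq heq hval
  exact (uniqueDiffWithinAt_Ioi x).eq_deriv _ h1 h2

/-- If the order of the values `φ x + x φ'(x) (ζ - 1)` is that of `x ^ s * h ζ`, for `x > c` and
`ζ ≥ 0`, then `φ` is an affine function of a power on `(c, ∞)`. -/
theorem exists_eq_add_mul_rpow_of_order {φ h : ℝ → ℝ} {c s : ℝ} (hc : 0 ≤ c)
    (hmono : StrictMonoOn φ (Set.Ici 0)) (hconv : ConvexOn ℝ (Set.Ici 0) φ)
    (hd : ∀ x, 0 < x → DifferentiableAt ℝ φ x) (h1 : h 1 = 1)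
    (hlt : ∀ x y ζ η, c < x → c < y → 0 ≤ ζ → 0 ≤ η →
      φ x + x * deriv φ x * (ζ - 1) < φ y + y * deriv φ y * (η - 1) →
      x ^ s * h ζ < y ^ s * h η)
    (heq : ∀ x y ζ η, c < x → c < y → 0 ≤ ζ → 0 ≤ η →
      φ x + x * deriv φ x * (ζ - 1) = φ y + y * deriv φ y * (η - 1) →
      x ^ s * h ζ = y ^ s * h η) :
    ∃ κ b a : ℝ, 1 ≤ κ ∧ 0 < b ∧ ∀ x, c < x → φ x = a + b * x ^ κ := by
  have hpos : ∀ x, 0 < x → 0 < deriv φ x := fun x hx => deriv_pos_of_convexOn hmono hconv hx (hd x hx)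
  have hψ : ∀ x, c < x → 0 < x * deriv φ x := fun x hx =>
    mul_pos (hc.trans_lt hx) (hpos x (hc.trans_lt hx))
  have hhmono : ∀ ζ η, 0 ≤ ζ → 0 ≤ η → ζ < η → h ζ < h η := by
    intro ζ η hζ hη hlt'
    have hx : c < c + 1 := by linarith
    have := hlt (c + 1) (c + 1) ζ η hx hx hζ hη (by nlinarith [hψ _ hx])
    exact lt_of_mul_lt_mul_left this (by positivity)
  have hdil : ∀ x t, c < x → c < t * x → 0 ≤ 1 + (φ (t * x) - φ x) / (x * deriv φ x) ∧
      h (1 + (φ (t * x) - φ x) / (x * deriv φ x)) = t ^ s := by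
    intro x t hx htx
    have hx0 : 0 < x := hc.trans_lt hx
    have ht : 0 < t := pos_of_mul_pos_left (hc.trans_lt htx) hx0.le
    have hψx := hψ x hx
    have hnn : 0 ≤ 1 + (φ (t * x) - φ x) / (x * deriv φ x) := by
      -- The tangent inequality gives `ζ ≥ t > 0`, so the comparison point is admissible.
      have h2 := deriv_mul_sub_le_of_convexOn hconv hx0.le (y := t * x) (by positivity) (hd x hx0)
      have h3 : t - 1 ≤ (φ (t * x) - φ x) / (x * deriv φ x) := by
        rw [le_div_iff₀ hψx]; linarith
      linarith
    refine ⟨hnn, ?_⟩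
    have h2 := heq x (t * x) _ 1 hx htx hnn zero_le_one (by
      rw [add_sub_cancel_left, mul_div_cancel₀ _ hψx.ne']; ring)
    rw [h1, mul_one, Real.mul_rpow ht.le hx0.le, mul_comm] at h2
    exact mul_right_cancel₀ (Real.rpow_pos_of_pos hx0 s).ne' h2
  refine exists_eq_add_mul_rpow hc (fun x hx => hd x (hc.trans_lt hx))
    (fun x hx => hpos x (hc.trans_lt hx))
    (hmono.mono fun x hx => hc.trans (le_of_lt hx)) ?_ ?_
  · exact (hconv.subset (fun x hx => hc.trans (le_of_lt hx)) (convex_Ioi c)).monotoneOn_deriv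
      fun x hx => hd x (hc.trans_lt hx)
  · intro x y t hx hy htx hty
    obtain ⟨hn1, he1⟩ := hdil x t hx htx
    obtain ⟨hn2, he2⟩ := hdil y t hy hty
    have h2 : 1 + (φ (t * x) - φ x) / (x * deriv φ x)
        = 1 + (φ (t * y) - φ y) / (y * deriv φ y) := by
      rcases lt_trichotomy (1 + (φ (t * x) - φ x) / (x * deriv φ x))
        (1 + (φ (t * y) - φ y) / (y * deriv φ y)) with h3 | h3 | h3
      · exact absurd (hhmono _ _ hn1 hn2 h3) (by rw [he1, he2]; exact lt_irrefl _)
      · exact h3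
      · exact absurd (hhmono _ _ hn2 hn1 h3) (by rw [he1, he2]; exact lt_irrefl _)
    have h3 := add_left_cancel h2
    rwa [div_eq_div_iff (hψ x hx).ne' (hψ y hy).ne'] at h3

/-! ### Attainable norms and cross integrals. -/

variable {X : Type*} [MeasurableSpace X] {ν : Measure X}

/-- Two densities `q`, `p` with prescribed `⟨p ^ (1 + γ)⟩` and `⟨q p ^ γ⟩ / ⟨p ^ (1 + γ)⟩`. The
density `p` is constant on a set of measure `m` up to a high narrow spike, and vanishes on a set
of positive measure. -/
theorem exists_powInt_eq_crossInt_eq (hν : HasSubsetsOfMeasure ν) {γ m P ζ : ℝ} (hγ : 0 < γ)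
    (hm : 0 < m) (hmν : ENNReal.ofReal m < ν Set.univ) (hP : m ^ (-γ) < P) (hζ : 0 ≤ ζ) :
    ∃ q p, q ∈ DensityClass ν γ ∧ p ∈ DensityClass ν γ ∧ powInt ν γ p = P ∧
      crossInt ν γ q p = ζ * P := by
  obtain ⟨m', hm'0, hmm', hm'⟩ := ENNReal.lt_iff_exists_real_btwn.1 hmν
  have hmm'' : m < m' := by
    by_contra! h
    exact absurd hmm' (not_lt.2 (ENNReal.ofReal_le_ofReal h))
  set r := (m' - m) / 2 with hr
  have hr0 : 0 < r := by rw [hr]; linarith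
  set δ := P - m ^ (-γ) with hδ
  have hδ0 : 0 < δ := by rw [hδ]; linarith
  have hmγ : 0 < m ^ (-γ) := Real.rpow_pos_of_pos hm _
  have hP0 : 0 < P := hmγ.trans hP
  have hζP : 0 ≤ ζ * P := mul_nonneg hζ hP0.le
  have hrγ : 0 < r ^ γ := Real.rpow_pos_of_pos hr0 _
  -- `θ` is the mass of the spike. The last two bounds ensure `w ≤ 1` and `s ≤ r` below.
  obtain ⟨θ, hθ0, hθ1, hθ2, hθ3⟩ : ∃ θ : ℝ, 0 < θ ∧ θ < 1 ∧ θ * (ζ * P) ≤ δ ∧ θ ≤ δ * r ^ γ := by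
    refine ⟨min (1 / 2) (min (δ / (ζ * P + 1)) (δ * r ^ γ)), by positivity, ?_, ?_, ?_⟩
    · exact (min_le_left _ _).trans_lt (by norm_num)
    · have h1 : min (1 / 2) (min (δ / (ζ * P + 1)) (δ * r ^ γ)) ≤ δ / (ζ * P + 1) :=
        (min_le_right _ _).trans (min_le_left _ _)
      rw [le_div_iff₀ (by positivity)] at h1
      have : 0 ≤ min (1 / 2) (min (δ / (ζ * P + 1)) (δ * r ^ γ)) := by positivity
      linarith
    · exact (min_le_right _ _).trans (min_le_right _ _)
  set D := P - (1 - θ) ^ (1 + γ) * m ^ (-γ) with hD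
  have hδD : δ ≤ D := by
    have : (1 - θ) ^ (1 + γ) ≤ 1 :=
      Real.rpow_le_one (by linarith) (by linarith) (by linarith)
    rw [hδ, hD]
    nlinarith
  have hD0 : 0 < D := hδ0.trans_le hδD
  have hθγ : 0 < θ ^ (1 + γ) := Real.rpow_pos_of_pos hθ0 _
  -- The width at which a spike of mass `θ` contributes exactly `D` to `⟨p ^ (1 + γ)⟩`.
  set s := (θ ^ (1 + γ) / D) ^ (1 / γ) with hs
  have hs0 : 0 < s := Real.rpow_pos_of_pos (by positivity) _
  have hsγ : s ^ γ = θ ^ (1 + γ) / D := by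
    rw [hs, ← Real.rpow_mul (by positivity), one_div_mul_cancel hγ.ne', Real.rpow_one]
  have hθsplit : θ ^ (1 + γ) = θ * θ ^ γ := by rw [Real.rpow_add hθ0, Real.rpow_one]
  have hsr : s ≤ r := by
    rw [← Real.rpow_le_rpow_iff hs0.le hr0.le hγ, hsγ, div_le_iff₀ hD0]
    have h1 : θ ^ γ ≤ 1 := Real.rpow_le_one hθ0.le hθ1.le hγ.le
    have h2 : δ * r ^ γ ≤ D * r ^ γ := by gcongr
    rw [hθsplit]
    nlinarith
  have hv : (θ / s) ^ γ = D / θ := by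
    have := Real.rpow_pos_of_pos hθ0 γ
    rw [Real.div_rpow hθ0.le hs0.le, hsγ, hθsplit]
    field_simp
  -- The mass of `q` on the spike; the rest lies where `p` vanishes and adds nothing to `⟨q p ^ γ⟩`.
  set w := ζ * P * θ / D with hw
  have hw0 : 0 ≤ w := by positivity
  have hw1 : w ≤ 1 := by
    rw [hw, div_le_one hD0]; linarith
  obtain ⟨A, hAm, hA, hAν⟩ := hν.exists_disjoint_triple ![m, s, r]
    (by intro i; fin_cases i <;> assumption)
    (by
      refine (ENNReal.ofReal_le_ofReal ?_).trans_lt hm'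
      simp only [Matrix.cons_val]
      linarith)
  have hmpos : ∀ i, 0 < (![m, s, r] : Fin 3 → ℝ) i := by intro i; fin_cases i <;> assumption
  refine ⟨step A ![0, w / s, (1 - w) / r], step A ![(1 - θ) / m, θ / s, 0],
    step_mem_densityClass hA hmpos hAm hAν hγ ?_ ?_,
    step_mem_densityClass hA hmpos hAm hAν hγ ?_ ?_, ?_, ?_⟩
  · intro i
    fin_cases i
    · exact le_rfl
    · exact div_nonneg hw0 hs0.le
    · exact div_nonneg (by linarith) hr0.le
  · simp only [Fin.sum_univ_three, Matrix.cons_val]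
    field_simp
    ring
  · intro i
    fin_cases i
    · exact div_nonneg (by linarith) hm.le
    · exact div_nonneg hθ0.le hs0.le
    · exact le_rfl
  · simp only [Fin.sum_univ_three, Matrix.cons_val]
    field_simp
    ring
  · rw [powInt_step hA hmpos hAm hAν hγ]
    simp only [Fin.sum_univ_three, Matrix.cons_val]
    have h1 : m * ((1 - θ) / m) ^ (1 + γ) = (1 - θ) ^ (1 + γ) * m ^ (-γ) := by
      rw [Real.div_rpow (by linarith) hm.le, Real.rpow_add hm, Real.rpow_one, Real.rpow_neg hm.le]
      have := Real.rpow_pos_of_pos hm γ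
      field_simp
    have h2 : s * (θ / s) ^ (1 + γ) = D := by
      rw [Real.rpow_add (by positivity), Real.rpow_one, hv]
      field_simp
    rw [h1, h2, Real.zero_rpow (by positivity), hD]
    ring
  · rw [crossInt_step hA hmpos hAm hAν]
    simp only [Fin.sum_univ_three, Matrix.cons_val]
    rw [hv, Real.zero_rpow hγ.ne', hw]
    field_simp
    ring

theorem powInt_nonneg {γ : ℝ} {p : X → ℝ} (hp : p ∈ DensityClass ν γ) : 0 ≤ powInt ν γ p :=
  integral_nonneg_of_ae (hp.1.nonneg.mono fun _ hx => Real.rpow_nonneg hx _)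

theorem powInt_pos {γ : ℝ} (hγ : 0 < γ) {p : X → ℝ} (hp : p ∈ DensityClass ν γ) :
    0 < powInt ν γ p := by
  refine (powInt_nonneg hp).lt_of_ne fun h => ?_
  have h0 := (integral_eq_zero_iff_of_nonneg_ae
    (hp.1.nonneg.mono fun _ hx => Real.rpow_nonneg hx _) hp.2).1 h.symm
  have h1 : p =ᵐ[ν] 0 := by
    filter_upwards [h0, hp.1.nonneg] with x hx hx0
    exact (Real.rpow_eq_zero hx0 (by positivity)).1 hx
  have h2 := hp.1.integral_eq_one
  rw [integral_congr_ae h1] at h2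
  simp at h2

theorem lnorm_pos {γ : ℝ} (hγ : 0 < γ) {p : X → ℝ} (hp : p ∈ DensityClass ν γ) :
    0 < lnorm ν γ p :=
  Real.rpow_pos_of_pos (powInt_pos hγ hp) _

theorem lnorm_rpow {γ : ℝ} (hγ : 0 < γ) {p : X → ℝ} (hp : p ∈ DensityClass ν γ) :
    lnorm ν γ p ^ (1 + γ) = powInt ν γ p := by
  rw [lnorm, ← Real.rpow_mul (powInt_nonneg hp), one_div_mul_cancel (by positivity), Real.rpow_one]

/-- On a space of finite measure the uniform density has the smallest norm. -/
theorem rpow_le_powInt [IsFiniteMeasure ν] {γ : ℝ} (hγ : 0 < γ) {p : X → ℝ}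
    (hp : p ∈ DensityClass ν γ) : ν.real Set.univ ^ (-γ) ≤ powInt ν γ p := by
  set M := ν.real Set.univ with hM
  have hM0 : 0 < M := by
    refine measureReal_nonneg.lt_of_ne fun h => ?_
    have h0 : ν = 0 := by
      rw [← Measure.measure_univ_eq_zero]
      exact (measureReal_eq_zero_iff).1 h.symm
    have h2 := hp.1.integral_eq_one
    rw [h0, integral_zero_measure] at h2
    exact zero_ne_one h2
  have hMγ : 0 < M ^ (-(1 + γ)) := Real.rpow_pos_of_pos hM0 _
  -- Bernoulli's inequality for `(M p)^(1+γ)`; the linear term integrates to 0.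
  have hle : ∀ᵐ x ∂ν, M ^ (-(1 + γ)) * (1 + (1 + γ) * (M * p x - 1)) ≤ p x ^ (1 + γ) := by
    filter_upwards [hp.1.nonneg] with x hx
    have hx' : 0 ≤ p x := hx
    have hMx : 0 ≤ M * p x := by positivity
    have h1 := one_add_mul_self_le_rpow_one_add (s := M * p x - 1) (by linarith)
      (p := 1 + γ) (by linarith)
    rw [add_sub_cancel, Real.mul_rpow hM0.le hx'] at h1
    calc _ ≤ M ^ (-(1 + γ)) * (M ^ (1 + γ) * p x ^ (1 + γ)) := by gcongr
      _ = p x ^ (1 + γ) := by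
        rw [← mul_assoc, ← Real.rpow_add hM0, neg_add_cancel, Real.rpow_zero, one_mul]
  have hi : Integrable (fun x => (1 + γ) * (M * p x - 1)) ν :=
    ((hp.1.integrable.const_mul M).sub (integrable_const 1)).const_mul _
  have hint := integral_mono_ae (((integrable_const 1).add hi).const_mul _) hp.2 hle
  have hcalc : ∫ x, M ^ (-(1 + γ)) * (1 + (1 + γ) * (M * p x - 1)) ∂ν = M ^ (-γ) := by
    rw [integral_const_mul, integral_add (integrable_const 1) hi, integral_const_mul,
      integral_sub (hp.1.integrable.const_mul M) (integrable_const 1), integral_const_mul,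
      hp.1.integral_eq_one, integral_const, smul_eq_mul, ← hM]
    have : M ^ (-γ) = M ^ (-(1 + γ)) * M := by
      rw [← Real.rpow_add_one hM0.ne']; congr 1; ring
    rw [this]
    ring
  rw [← hcalc]
  exact hint

/-- The infimum of the norms of densities, with densities of all larger norms. -/
theorem exists_lnorm_threshold (hν : HasSubsetsOfMeasure ν) (hν0 : ν ≠ 0) {γ : ℝ} (hγ : 0 < γ) :
    ∃ c : ℝ, 0 ≤ c ∧ (∀ p ∈ DensityClass ν γ, c ≤ lnorm ν γ p) ∧
      ∀ N ζ, c < N → 0 ≤ ζ → ∃ q p, q ∈ DensityClass ν γ ∧ p ∈ DensityClass ν γ ∧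
        lnorm ν γ p = N ∧ crossInt ν γ q p / powInt ν γ p = ζ := by
  -- The measure in the last condition is that of a set whose uniform density has norm `N`. It
  -- leaves room for a spike exactly when it is less than the total measure.
  obtain ⟨c, hc, hle, hlt⟩ : ∃ c : ℝ, 0 ≤ c ∧ (∀ p ∈ DensityClass ν γ, c ≤ lnorm ν γ p) ∧
      ∀ N, c < N → ENNReal.ofReal ((N ^ (1 + γ)) ^ (-(1 / γ))) < ν Set.univ := by
    by_cases h : ν Set.univ = ⊤
    · exact ⟨0, le_rfl, fun p hp => (lnorm_pos hγ hp).le, fun N _ => h ▸ ENNReal.ofReal_lt_top⟩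
    · have : IsFiniteMeasure ν := ⟨lt_top_iff_ne_top.2 h⟩
      have hM0 : 0 < ν.real Set.univ :=
        ENNReal.toReal_pos (fun h0 => hν0 (Measure.measure_univ_eq_zero.1 h0)) h
      refine ⟨(ν.real Set.univ ^ (-γ)) ^ (1 / (1 + γ)), by positivity, fun p hp => ?_,
        fun N hN => ?_⟩
      · exact Real.rpow_le_rpow (by positivity) (rpow_le_powInt hγ hp) (by positivity)
      · have h1 : ν.real Set.univ ^ (-γ) < N ^ (1 + γ) := by
          have := Real.rpow_lt_rpow (by positivity) hN (show 0 < 1 + γ by positivity)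
          rwa [← Real.rpow_mul (by positivity), one_div_mul_cancel (by positivity),
            Real.rpow_one] at this
        have h2 := Real.rpow_lt_rpow_of_neg (by positivity) h1
          (show -(1 / γ) < 0 by simpa using hγ)
        rw [← Real.rpow_mul hM0.le, neg_mul_neg, mul_one_div_cancel hγ.ne', Real.rpow_one] at h2
        rwa [ENNReal.ofReal_lt_iff_lt_toReal (by
          have : 0 < N := lt_of_le_of_lt (by positivity) hN
          positivity) h]
  refine ⟨c, hc, hle, fun N ζ hN hζ => ?_⟩
  have hN0 : 0 < N := hc.trans_lt hN
  have hP0 : 0 < N ^ (1 + γ) := Real.rpow_pos_of_pos hN0 _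
  have hm0 : 0 < (N ^ (1 + γ)) ^ (-(1 / γ)) := Real.rpow_pos_of_pos hP0 _
  obtain ⟨m, -, hm1, hm2⟩ := ENNReal.lt_iff_exists_real_btwn.1 (hlt N hN)
  have hm : (N ^ (1 + γ)) ^ (-(1 / γ)) < m := by
    by_contra! h
    exact absurd hm1 (not_lt.2 (ENNReal.ofReal_le_ofReal h))
  have hmP : m ^ (-γ) < N ^ (1 + γ) := by
    have := Real.rpow_lt_rpow_of_neg hm0 hm (show -γ < 0 by linarith)
    rwa [← Real.rpow_mul hP0.le, neg_mul_neg, one_div_mul_cancel hγ.ne', Real.rpow_one] at this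
  obtain ⟨q, p, hq, hp, h1, h2⟩ :=
    exists_powInt_eq_crossInt_eq hν hγ (hm0.trans hm) hm2 hmP hζ
  refine ⟨q, p, hq, hp, ?_, ?_⟩
  · rw [lnorm, h1, ← Real.rpow_mul hN0.le, mul_one_div_cancel (by positivity), Real.rpow_one]
  · rw [h1, h2, mul_div_cancel_right₀ _ hP0.ne']

/-! ### The cross-entropies as functions of `N` and `ζ`. -/

theorem nbCE_dom_of_pos (φ : ℝ → ℝ → ℝ) {γ : ℝ} (hγ : 0 < γ) :
    (nbCE ν φ γ).dom = DensityClass ν γ ×ˢ DensityClass ν γ := if_neg hγ.ne'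

theorem nbCE_val_of_pos (φ : ℝ → ℝ → ℝ) {γ : ℝ} (hγ : 0 < γ) (q : X → ℝ) {p : X → ℝ}
    (hp : p ∈ DensityClass ν γ) :
    (nbCE ν φ γ).val q p = -(φ γ (lnorm ν γ p) + lnorm ν γ p * deriv (φ γ) (lnorm ν γ p) *
      (crossInt ν γ q p / powInt ν γ p - 1) - φ 0 1) / γ := by
  have hN := lnorm_pos hγ hp
  have hNγ := Real.rpow_pos_of_pos hN γ
  have hP : powInt ν γ p = lnorm ν γ p * lnorm ν γ p ^ γ := by
    rw [← lnorm_rpow hγ hp, Real.rpow_add hN, Real.rpow_one]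
  simp only [nbCE, if_neg hγ.ne', hP]
  field_simp
  ring

theorem bregmanHolderCE_val {κ γ : ℝ} (hκ : 1 ≤ κ) (q p : X → ℝ) :
    (bregmanHolderCE ν κ γ).val q p =
      (1 - lnorm ν γ p ^ κ * (1 + κ * (crossInt ν γ q p / powInt ν γ p - 1))) / γ := by
  have : κ ≠ 0 := by linarith
  simp only [bregmanHolderCE]
  generalize crossInt ν γ q p / powInt ν γ p = z
  generalize lnorm ν γ p ^ κ = y
  field_simp
  ring

theorem holderCE_val (H : ℝ → ℝ) {γ : ℝ} (hγ : 0 < γ) (q : X → ℝ) {p : X → ℝ}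
    (hp : p ∈ DensityClass ν γ) :
    (holderCE ν H γ).val q p =
      (1 + lnorm ν γ p ^ (1 + γ) * H (crossInt ν γ q p / powInt ν γ p)) / γ := by
  simp only [holderCE]
  rw [lnorm_rpow hγ hp]
  ring

theorem IsNBGenerator.differentiableAt {φ : ℝ → ℝ → ℝ} {γ g x : ℝ} (hφ : IsNBGenerator φ γ)
    (hg : 0 ≤ g) (hx : 0 < x) : DifferentiableAt ℝ (φ g) x :=
  (hφ.differentiableOn g hg).differentiableAt (Ioi_mem_nhds hx)

theorem IsNBGenerator.deriv_pos {φ : ℝ → ℝ → ℝ} {γ g x : ℝ} (hφ : IsNBGenerator φ γ)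
    (hg : 0 ≤ g) (hx : 0 < x) : 0 < deriv (φ g) x :=
  deriv_pos_of_convexOn (hφ.strictMonoOn g hg) (hφ.convexOn g hg) hx (hφ.differentiableAt hg hx)

/-- For equal power parameters, a norm-based Bregman cross-entropy which is weakly equivalent to
a Hölder cross-entropy is a Bregman–Hölder cross-entropy. -/
theorem exists_equivalent_bregmanHolderCE (hν : HasSubsetsOfMeasure ν) (hν0 : ν ≠ 0) {γ : ℝ}
    (hγ : 0 < γ) {φ : ℝ → ℝ → ℝ} {H : ℝ → ℝ} (hφ : IsNBGenerator φ γ)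
    (hH : IsHolderGenerator H γ) (h : WeaklyEquivalent (nbCE ν φ γ) (holderCE ν H γ)) :
    ∃ κ : ℝ, 1 ≤ κ ∧ Equivalent (bregmanHolderCE ν κ γ) (nbCE ν φ γ) := by
  obtain ⟨ξ, hξ, hξv⟩ := h
  obtain ⟨c, hc, hle, hex⟩ := exists_lnorm_threshold hν hν0 hγ
  set F : ℝ → ℝ → ℝ := fun N ζ => φ γ N + N * deriv (φ γ) N * (ζ - 1) with hF
  set V := {y | ∃ q p, (q, p) ∈ (nbCE ν φ γ).dom ∧ (q, p) ∈ (holderCE ν H γ).dom ∧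
    (nbCE ν φ γ).val q p = y} with hV
  have hval : ∀ N ζ, c < N → 0 ≤ ζ → -(F N ζ - φ 0 1) / γ ∈ V ∧
      ξ (-(F N ζ - φ 0 1) / γ) = (1 + N ^ (1 + γ) * H ζ) / γ := by
    intro N ζ hN hζ
    obtain ⟨q, p, hq, hp, h1, h2⟩ := hex N ζ hN hζ
    have hd1 : (q, p) ∈ (nbCE ν φ γ).dom := by rw [nbCE_dom_of_pos φ hγ]; exact ⟨hq, hp⟩
    have hd2 : (q, p) ∈ (holderCE ν H γ).dom := ⟨hq, hp⟩
    have h3 := nbCE_val_of_pos φ hγ q hp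
    have h4 := holderCE_val H hγ q hp
    rw [h1, h2] at h3 h4
    refine ⟨⟨q, p, hd1, hd2, h3⟩, ?_⟩
    rw [← h4, hξv q p hd1 hd2, h3]
  obtain ⟨κ, b, a, hκ, hb, hform⟩ := exists_eq_add_mul_rpow_of_order (φ := φ γ)
    (h := fun ζ => -H ζ) (s := 1 + γ) hc (hφ.strictMonoOn γ hγ.le) (hφ.convexOn γ hγ.le)
    (fun x hx => hφ.differentiableAt hγ.le hx) (by simp [hH.at_one])
    (by
      intro x y ζ η hx hy hζ hη hlt
      obtain ⟨m1, e1⟩ := hval x ζ hx hζ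
      obtain ⟨m2, e2⟩ := hval y η hy hη
      have h1 : -(F y η - φ 0 1) / γ < -(F x ζ - φ 0 1) / γ := by
        rw [div_lt_div_iff_of_pos_right hγ]; simp only [hF]; linarith
      have h2 := hξ m2 m1 h1
      rw [e1, e2, div_lt_div_iff_of_pos_right hγ] at h2
      linarith)
    (by
      intro x y ζ η hx hy hζ hη heq
      obtain ⟨m1, e1⟩ := hval x ζ hx hζ
      obtain ⟨m2, e2⟩ := hval y η hy hη
      have h1 : F x ζ = F y η := heq
      rw [h1, e2, div_left_inj' hγ.ne'] at e1
      linarith)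
  refine ⟨κ, hκ, fun y => b * y - (a + b - φ 0 1) / γ, ?_, ?_⟩
  · intro y z hyz
    have := mul_lt_mul_of_pos_left hyz hb
    simp only
    linarith
  · rintro q p ⟨hq, hp⟩ -
    have hN := lnorm_pos hγ hp
    obtain ⟨h1, h2⟩ := eq_add_mul_rpow_of_forall_gt hform hN (hle p hp)
      (hφ.differentiableAt hγ.le hN)
    rw [nbCE_val_of_pos φ hγ q hp, bregmanHolderCE_val hκ, h1, h2, Real.rpow_sub_one hN.ne']
    generalize crossInt ν γ q p / powInt ν γ p = z
    field_simp
    ring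

/-! ### Equality of the power parameters. -/

/-- Cross-entropies with different power parameters distinguish between densities `q`: there are
`p`, `q₁`, `q₂` with equal `⟨q p ^ γ'⟩` and different `⟨q p ^ γ⟩`, or `⟨q log p⟩` if `γ = 0`. -/
theorem power_eq_of_weaklyEquivalent (hν : HasSubsetsOfMeasure ν) (hν0 : ν ≠ 0) {γ γ' : ℝ}
    (hγ : 0 ≤ γ) (hγ' : 0 < γ') {φ : ℝ → ℝ → ℝ} {H : ℝ → ℝ} (hφ : IsNBGenerator φ γ)
    (h : WeaklyEquivalent (nbCE ν φ γ) (holderCE ν H γ')) : γ = γ' := by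
  by_contra hne
  obtain ⟨ξ, hξ, hξv⟩ := h
  have hpos : 0 < ν Set.univ := pos_iff_ne_zero.2 fun h0 => hν0 (Measure.measure_univ_eq_zero.1 h0)
  obtain ⟨m', hm'0, hm'1, hm'⟩ := ENNReal.lt_iff_exists_real_btwn.1 hpos
  have hm'pos : 0 < m' := ENNReal.ofReal_pos.1 hm'1
  set m := m' / 3 with hm
  have hm0 : 0 < m := by positivity
  obtain ⟨A, hAm, hA, hAν⟩ := hν.exists_disjoint_triple (fun _ => m) (fun _ => hm0)
    (by
      refine (ENNReal.ofReal_le_ofReal ?_).trans_lt hm'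
      rw [hm]; linarith)
  have hmpos : ∀ _ : Fin 3, 0 < m := fun _ => hm0
  obtain ⟨a, b, c, ha, hab, hbc, habc⟩ : ∃ a b c : ℝ, 0 < a ∧ a < b ∧ b < c ∧
      m * a + m * b + m * c = 1 := by
    refine ⟨1 / (6 * m), 2 / (6 * m), 3 / (6 * m), by positivity, ?_, ?_, ?_⟩
    · gcongr; norm_num
    · gcongr; norm_num
    · field_simp; norm_num
  have hb : 0 < b := ha.trans hab
  have hc : 0 < c := hb.trans hbc
  have hxy : a ^ γ' < b ^ γ' := Real.rpow_lt_rpow ha.le hab hγ'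
  have hyz : b ^ γ' < c ^ γ' := Real.rpow_lt_rpow hb.le hbc hγ'
  have ha' : 0 < a ^ γ' := Real.rpow_pos_of_pos ha _
  have hc' : 0 < c ^ γ' := Real.rpow_pos_of_pos hc _
  -- This weight makes the two-point density `u₂` on the extreme levels match `u₁`, concentrated on
  -- the middle level, in `⟨q p ^ γ'⟩`.
  obtain ⟨w, hw0, hw1, hw⟩ : ∃ w : ℝ, 0 < w ∧ w < 1 ∧
      w * a ^ γ' + (1 - w) * c ^ γ' = b ^ γ' := by
    refine ⟨(c ^ γ' - b ^ γ') / (c ^ γ' - a ^ γ'), ?_, ?_, ?_⟩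
    · exact div_pos (by linarith) (by linarith)
    · rw [div_lt_one (by linarith)]; linarith
    · have : c ^ γ' - a ^ γ' ≠ 0 := by linarith
      field_simp
      ring
  set v : Fin 3 → ℝ := ![a, b, c] with hv
  set u₁ : Fin 3 → ℝ := ![0, 1 / m, 0] with hu₁
  set u₂ : Fin 3 → ℝ := ![w / m, 0, (1 - w) / m] with hu₂
  have hv0 : ∀ i, 0 < v i := by intro i; fin_cases i <;> assumption
  have hu₁0 : ∀ i, 0 ≤ u₁ i := by
    intro i
    fin_cases i
    · exact le_rfl
    · exact (one_div_pos.2 hm0).le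
    · exact le_rfl
  have hu₂0 : ∀ i, 0 ≤ u₂ i := by
    intro i
    fin_cases i
    · exact div_nonneg hw0.le hm0.le
    · exact le_rfl
    · exact div_nonneg (by linarith) hm0.le
  have hv1 : ∑ i, m * v i = 1 := by simpa [Fin.sum_univ_three, hv] using habc
  have hu₁1 : ∑ i, m * u₁ i = 1 := by
    simp only [Fin.sum_univ_three, hu₁, Matrix.cons_val]; field_simp; ring
  have hu₂1 : ∑ i, m * u₂ i = 1 := by
    simp only [Fin.sum_univ_three, hu₂, Matrix.cons_val]; field_simp; ring
  have hsum₁ : ∀ G : ℝ → ℝ, ∑ i, m * (u₁ i * G (v i)) = G b := by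
    intro G
    simp only [Fin.sum_univ_three, hu₁, hv, Matrix.cons_val]; field_simp; ring
  have hsum₂ : ∀ G : ℝ → ℝ, ∑ i, m * (u₂ i * G (v i)) = w * G a + (1 - w) * G c := by
    intro G
    simp only [Fin.sum_univ_three, hu₂, hv, Matrix.cons_val]; field_simp; ring
  have hholder : ∀ u : Fin 3 → ℝ, (∀ i, 0 ≤ u i) → ∑ i, m * u i = 1 →
      (step A u, step A v) ∈ (holderCE ν H γ').dom := fun u hu hu1 =>
    ⟨step_mem_densityClass hA hmpos hAm hAν hγ' hu hu1,
      step_mem_densityClass hA hmpos hAm hAν hγ' (fun i => (hv0 i).le) hv1⟩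
  have hH : (holderCE ν H γ').val (step A u₁) (step A v) =
      (holderCE ν H γ').val (step A u₂) (step A v) := by
    have : crossInt ν γ' (step A u₁) (step A v) = crossInt ν γ' (step A u₂) (step A v) := by
      rw [crossInt_step hA hmpos hAm hAν, crossInt_step hA hmpos hAm hAν,
        hsum₁ fun t => t ^ γ', hsum₂ fun t => t ^ γ', hw]
    simp only [holderCE, this]
  have hnb : ∀ u : Fin 3 → ℝ, (∀ i, 0 ≤ u i) → ∑ i, m * u i = 1 →
      (step A u, step A v) ∈ (nbCE ν φ γ).dom := by
    intro u hu hu1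
    rcases hγ.eq_or_lt with h0 | h0
    · simp only [nbCE, if_pos h0.symm, Set.mem_ofPred_eq]
      refine ⟨isDensity_step hmpos hAm hAν hu hu1,
        isDensity_step hmpos hAm hAν (fun i => (hv0 i).le) hv1, .of_forall fun x hx => ?_, ?_⟩
      · refine step_of_forall_notMem u fun i hi => ?_
        rw [step_of_mem hA v hi] at hx
        exact (hv0 i).ne' hx
      · rw [comp_step hA (fun s t => s * Real.log t) (zero_mul _) u v]
        exact integrable_step hAm hAν _
    · rw [nbCE_dom_of_pos φ h0]
      exact ⟨step_mem_densityClass hA hmpos hAm hAν h0 hu hu1,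
        step_mem_densityClass hA hmpos hAm hAν h0 (fun i => (hv0 i).le) hv1⟩
  have hN : (nbCE ν φ γ).val (step A u₁) (step A v) =
      (nbCE ν φ γ).val (step A u₂) (step A v) := by
    have d1 := hnb u₁ hu₁0 hu₁1
    have d2 := hnb u₂ hu₂0 hu₂1
    have e1 := hholder u₁ hu₁0 hu₁1
    have e2 := hholder u₂ hu₂0 hu₂1
    refine hξ.injOn ⟨_, _, d1, e1, rfl⟩ ⟨_, _, d2, e2, rfl⟩ ?_
    rw [← hξv _ _ d1 e1, ← hξv _ _ d2 e2, hH]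
  rcases hγ.eq_or_lt with h0 | h0
  · simp only [nbCE, if_pos h0.symm] at hN
    have hd : 0 < deriv (φ 0) 1 := hφ.deriv_pos le_rfl one_pos
    have hlog := fun u : Fin 3 → ℝ => comp_step hA (fun s t => s * Real.log t) (zero_mul _) u v
    rw [hlog, hlog, integral_step hmpos hAm hAν, integral_step hmpos hAm hAν, hsum₁, hsum₂] at hN
    have hN' : Real.log b = w * Real.log a + (1 - w) * Real.log c :=
      mul_left_cancel₀ hd.ne' (by linarith)
    have hcv := strictConcaveOn_log_Ioi.2 (Set.mem_Ioi.2 ha') (Set.mem_Ioi.2 hc')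
      (hxy.trans hyz).ne hw0 (sub_pos.2 hw1) (by ring)
    simp only [smul_eq_mul, hw, Real.log_rpow ha, Real.log_rpow hb, Real.log_rpow hc] at hcv
    nlinarith
  · have hpv := step_mem_densityClass hA hmpos hAm hAν h0 (fun i => (hv0 i).le) hv1
    have hd := hφ.deriv_pos h0.le (lnorm_pos h0 hpv)
    have hψ := mul_pos (lnorm_pos h0 hpv) hd
    have hP := powInt_pos h0 hpv
    rw [nbCE_val_of_pos φ h0 _ hpv, nbCE_val_of_pos φ h0 _ hpv, div_left_inj' h0.ne', neg_inj,
      sub_left_inj, add_right_inj, mul_right_inj' hψ.ne', sub_left_inj, div_left_inj' hP.ne',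
      crossInt_step hA hmpos hAm hAν, crossInt_step hA hmpos hAm hAν, hsum₁ fun t => t ^ γ,
      hsum₂ fun t => t ^ γ] at hN
    -- In the variable `t ^ γ'`, equality of `⟨q p ^ γ⟩` would be equality in Jensen's inequality
    -- for the power `γ / γ' ≠ 1`.
    have hpow : ∀ t : ℝ, 0 < t → (t ^ γ') ^ (γ / γ') = t ^ γ := by
      intro t ht
      rw [← Real.rpow_mul ht.le, mul_div_cancel₀ _ hγ'.ne']
    rcases lt_or_gt_of_ne hne with hlt | hlt
    · have hcv := (Real.strictConcaveOn_rpow (p := γ / γ') (by positivity)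
        ((div_lt_one hγ').2 hlt)).2 (Set.mem_Ici.2 ha'.le) (Set.mem_Ici.2 hc'.le)
        (hxy.trans hyz).ne hw0 (sub_pos.2 hw1) (by ring)
      simp only [smul_eq_mul, hw, hpow a ha, hpow b hb, hpow c hc] at hcv
      linarith
    · have hcv := (strictConvexOn_rpow (p := γ / γ') ((one_lt_div hγ').2 hlt)).2
        (Set.mem_Ici.2 ha'.le) (Set.mem_Ici.2 hc'.le)
        (hxy.trans hyz).ne hw0 (sub_pos.2 hw1) (by ring)
      simp only [smul_eq_mul, hw, hpow a ha, hpow b hb, hpow c hc] at hcv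
      linarith

/-! ### The converse: Bregman–Hölder cross-entropies lie in both classes. -/

/-- The power function `x ↦ x ^ r`, extended to the reals as an odd function. -/
noncomputable def oddRpow (r x : ℝ) : ℝ := if 0 ≤ x then x ^ r else -(-x) ^ r

theorem strictMono_oddRpow {r : ℝ} (hr : 0 < r) : StrictMono (oddRpow r) := by
  intro x y hxy
  unfold oddRpow
  split_ifs with hx hy hy
  · exact Real.rpow_lt_rpow hx hxy hr
  · linarith
  · have := Real.rpow_pos_of_pos (show 0 < -x by linarith) r
    have := Real.rpow_nonneg hy r
    linarith
  · exact neg_lt_neg (Real.rpow_lt_rpow (by linarith) (by linarith) hr)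

theorem oddRpow_mul {r x y : ℝ} (hx : 0 < x) : oddRpow r (x * y) = x ^ r * oddRpow r y := by
  unfold oddRpow
  by_cases hy : 0 ≤ y
  · rw [if_pos hy, if_pos (by positivity), Real.mul_rpow hx.le hy]
  · have hy' : y < 0 := not_le.1 hy
    rw [if_neg hy, if_neg (not_le.2 (mul_neg_of_pos_of_neg hx hy')), ← mul_neg,
      Real.mul_rpow hx.le (by linarith), mul_neg]

theorem exists_nbCE_equivalent {γ κ : ℝ} (hγ : 0 < γ) (hκ : 1 ≤ κ) :
    ∃ φ : ℝ → ℝ → ℝ, IsNBGenerator φ γ ∧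
      Equivalent (bregmanHolderCE ν κ γ) (nbCE ν φ γ) := by
  refine ⟨fun _ x => x ^ κ, ⟨fun _ _ => Real.strictMonoOn_rpow_Ici_of_exponent_pos (by linarith),
    fun _ _ => convexOn_rpow hκ, fun _ _ x hx => ?_, fun h => absurd h hγ.ne'⟩,
    id, strictMono_id, ?_⟩
  · exact (Real.hasDerivAt_rpow_const
      (Or.inl (ne_of_gt hx))).differentiableAt.differentiableWithinAt
  · rintro q p ⟨-, hp⟩ -
    have hN := lnorm_pos hγ hp
    rw [nbCE_val_of_pos _ hγ q hp, bregmanHolderCE_val hκ, Real.deriv_rpow_const,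
      Real.rpow_sub_one hN.ne', Real.one_rpow]
    simp only [id]
    generalize crossInt ν γ q p / powInt ν γ p = z
    field_simp
    ring

/-- `1 + κ (z - 1)` is negative for small `z` if `κ > 1`, whence the odd extension of the power,
which also makes `ξ` increasing on all of `ℝ`. The lower bound on `H` is Bernoulli's inequality `1 +
κ (z - 1) ≤ z ^ κ` raised to the power `r`. -/
theorem exists_holderCE_equivalent {γ κ : ℝ} (hγ : 0 < γ) (hκ : 1 ≤ κ) :
    ∃ H : ℝ → ℝ, IsHolderGenerator H γ ∧
      Equivalent (bregmanHolderCE ν κ γ) (holderCE ν H γ) := by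
  have hκ0 : 0 < κ := by linarith
  set r := (1 + γ) / κ with hr
  have hr0 : 0 < r := by positivity
  have hκr : κ * r = 1 + γ := by rw [hr]; field_simp
  refine ⟨fun z => -oddRpow r (1 + κ * (z - 1)), ⟨fun z hz => neg_le_neg ?_, ?_⟩,
    fun y => (1 - oddRpow r (1 - γ * y)) / γ, ?_, ?_⟩
  · have h1 := one_add_mul_self_le_rpow_one_add (s := z - 1) (by linarith) hκ
    rw [add_sub_cancel] at h1
    calc oddRpow r (1 + κ * (z - 1)) ≤ oddRpow r (z ^ κ) := (strictMono_oddRpow hr0).monotone h1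
      _ = z ^ (1 + γ) := by
        rw [oddRpow, if_pos (by positivity), ← Real.rpow_mul hz, hκr]
  · simp [oddRpow]
  · intro x y hxy
    have h1 : 1 - γ * y < 1 - γ * x := by nlinarith
    have h2 := strictMono_oddRpow hr0 h1
    simp only
    gcongr
  · rintro q p ⟨-, hp⟩ -
    have hN := lnorm_pos hγ hp
    rw [holderCE_val _ hγ q hp, bregmanHolderCE_val hκ]
    simp only
    rw [mul_div_cancel₀ _ hγ.ne', sub_sub_cancel,
      oddRpow_mul (Real.rpow_pos_of_pos hN κ), ← Real.rpow_mul hN.le, hκr]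
    ring

end NBDPD

theorem corollary1 (n : ℕ) (hn : 1 ≤ n) (S : Set (EuclideanSpace ℝ (Fin n)))
    (hS : MeasurableSet S) (hS0 : volume S ≠ 0) :
    -- a common member of the two classes is a Bregman–Hölder cross-entropy
    (∀ (γ γ' : ℝ) (φ : ℝ → ℝ → ℝ) (H : ℝ → ℝ), 0 ≤ γ → 0 < γ' →
      NBDPD.IsNBGenerator φ γ → NBDPD.IsHolderGenerator H γ' →
      NBDPD.WeaklyEquivalent (NBDPD.nbCE (volume.restrict S) φ γ)
        (NBDPD.holderCE (volume.restrict S) H γ') →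
      γ = γ' ∧ ∃ κ : ℝ, 1 ≤ κ ∧
        NBDPD.Equivalent (NBDPD.bregmanHolderCE (volume.restrict S) κ γ)
          (NBDPD.nbCE (volume.restrict S) φ γ)) ∧
    -- every Bregman–Hölder cross-entropy is a common member
    (∀ γ κ : ℝ, 0 < γ → 1 ≤ κ →
      (∃ φ : ℝ → ℝ → ℝ, NBDPD.IsNBGenerator φ γ ∧
        NBDPD.Equivalent (NBDPD.bregmanHolderCE (volume.restrict S) κ γ)
          (NBDPD.nbCE (volume.restrict S) φ γ)) ∧
      (∃ H : ℝ → ℝ, NBDPD.IsHolderGenerator H γ ∧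
        NBDPD.Equivalent (NBDPD.bregmanHolderCE (volume.restrict S) κ γ)
          (NBDPD.holderCE (volume.restrict S) H γ))) := by
  have hν := NBDPD.hasSubsetsOfMeasure_volume_restrict hn hS
  have hν0 : volume.restrict S ≠ 0 := fun h => hS0 (Measure.restrict_eq_zero.1 h)
  refine ⟨fun γ γ' φ H hγ hγ' hφ hH h => ?_, fun γ κ hγ hκ =>
    ⟨NBDPD.exists_nbCE_equivalent hγ hκ, NBDPD.exists_holderCE_equivalent hγ hκ⟩⟩
  obtain rfl := NBDPD.power_eq_of_weaklyEquivalent hν hν0 hγ hγ' hφ h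
  exact ⟨rfl, NBDPD.exists_equivalent_bregmanHolderCE hν hν0 hγ' hφ hH h⟩
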